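/- \textbf{Theorem (Advanced Composition Starting with Approximate DP).} Let $\mathcal{X}$ be a set, $n,k\ge 0$ integers, and fix any symmetric relation on $\mathcal{X}^n$, whose related pairs are called neighbouring datasets. A randomized algorithm $M:\mathcal{X}^n\to\mathcal{Y}$, with $\mathcal{Y}$ a measurable space, is \emph{$(\varepsilon,\delta)$-DP} if $\Pr[M(x)\in S]\le e^{\varepsilon}\Pr[M(x')\in S]+\delta$ for all neighbouring $x,x'\in\mathcal{X}^n$ and all measurable $S\subseteq\mathcal{Y}$. Let $\mathcal{Y}_0,\dots,\mathcal{Y}_k$ be measurable spaces and, for $j\in[k]=\{1,\dots,k\}$, let $M_j:\mathcal{X}^n\times\mathcal{Y}_{j-1}\to\mathcal{Y}_j$ be a randomized algorithm: for each $x\in\mathcal{X}^n$, the law of $M_j(x,y)$ is a probability distribution on $\mathcal{Y}_j$ that depends measurably on $y\in\mathcal{Y}_{j-1}$ (a Markov kernel). Let $\varepsilon_j,\delta_j\ge 0$ and suppose that, for each $j\in[k]$ and every fixed $y\in\mathcal{Y}_{j-1}$, the algorithm $x\mapsto M_j(x,y)$ is $(\varepsilon_j,\delta_j)$-DP. Fix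 $y_0\in\mathcal{Y}_0$, set $M_{1\cdots 0}(x)=y_0$, and for $j\in[k]$ define inductively $M_{1\cdots j}:\mathcal{X}^n\to\mathcal{Y}_j$ by $M_{1\cdots j}(x)=M_j(x,M_{1\cdots(j-1)}(x))$, where each algorithm is run with independent randomness. Then, for every $\delta>\sum_{j=1}^k\delta_j$, the composition $M_{1\cdots k}$ is $(\varepsilon,\delta)$-DP with \[\varepsilon=\min\left\{\sum_{j=1}^k\varepsilon_j,\ \frac12\sum_{j=1}^k\varepsilon_j^2+\sqrt{2\log(1/\delta')\sum_{j=1}^k\varepsilon_j^2}\right\},\qquad \delta'=\delta-\sum_{j=1}^k\delta_j.\] Here, if $\delta'>1$, so that $\log(1/\delta')<0$, the square root is read as $0$. -/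

import Mathlib

open MeasureTheory ProbabilityTheory

/-- Approximate differential privacy. A randomized algorithm with inputs in `D` and outputs in `Y`
is given by the law `M x` of its output on each input `x`. With respect to the relation `Nbr` of
neighbouring inputs, `M` is `(ε, δ)`-DP if
`Pr[M x ∈ S] ≤ exp ε * Pr[M x' ∈ S] + δ` for all neighbouring `x`, `x'` and all measurable `S`. -/
def IsApproxDP {D Y : Type*} [MeasurableSpace Y] (Nbr : D → D → Prop) (ε δ : ℝ)
    (M : D → Measure Y) : Prop :=
  ∀ x x' : D, Nbr x x' → ∀ S : Set Y, MeasurableSet S →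
    (M x).real S ≤ Real.exp ε * (M x').real S + δ

/-- Adaptive composition. The `j`-th algorithm sends a dataset `x` and the previous output `y` to a
random output with law `M j x y`. On the dataset `x`, `adaptiveComp M y₀ x j` is the law of the
output after the first `j` algorithms: start from the fixed value `y₀`, and in each step feed the
previous output to the next algorithm, which is run with fresh randomness. -/
noncomputable def adaptiveComp {D : Type*} {k : ℕ} {Y : Fin (k + 1) → Type*}
    [∀ j, MeasurableSpace (Y j)] (M : (j : Fin k) → D → Kernel (Y j.castSucc) (Y j.succ))
    (y₀ : Y 0) (x : D) (j : Fin (k + 1)) : Measure (Y j) :=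
  Fin.induction (motive := fun j => Measure (Y j)) (Measure.dirac y₀)
    (fun j μ => μ.bind (M j x)) j

/-- The output of the composition has a probability distribution as its law. -/
instance adaptiveComp.instIsProbabilityMeasure {D : Type*} {k : ℕ} {Y : Fin (k + 1) → Type*}
    [∀ j, MeasurableSpace (Y j)] (M : (j : Fin k) → D → Kernel (Y j.castSucc) (Y j.succ))
    [∀ j x, IsMarkovKernel (M j x)] (y₀ : Y 0) (x : D) (j : Fin (k + 1)) :
    IsProbabilityMeasure (adaptiveComp M y₀ x j) := by
  induction j using Fin.induction with
  | zero => exact inferInstanceAs (IsProbabilityMeasure (Measure.dirac y₀))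
  | succ j ih =>
    exact inferInstanceAs (IsProbabilityMeasure ((adaptiveComp M y₀ x j.castSucc).bind (M j x)))

/-!
Fix neighbouring datasets `x`, `x'` and an event `S` of the last stage. Write `f j y` and `g j y`
for the probabilities that the composition ends in `S` when it is run on `x`, respectively `x'`,
from the output `y` of stage `j`. The proof bounds `f j ≤ exp t * g j + h j t` simultaneously for
all real `t`, going backwards from `j = k`, where both functions are the indicator of `S`, to
`j = 0`, where they are the probabilities to be compared.

The step (`integral_le_exp_mul_integral_add_of_le`) is the fact that a pair of laws which are
`(ε, δ)`-close in both directions is dominated by randomized response: it turns the additive terms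
`h (t - ε)` and `h (t + ε)` into `(exp ε * h (t - ε) + h (t + ε)) / (1 + exp ε) + δ`, so the `δ j`
simply add up. It is proved by transferring two truncations of `f`, one in each direction; the
errors are proportional to the ranges of the truncations, which together have length at most one.
The step is applied separately for each previous output (`integral_adaptiveComp_le`), so it needs
no choice of decompositions depending measurably on that output.

It remains to choose `h`. An indicator of a half-line gives the exponent `∑ ε j`
(`adaptiveComp_real_le_exp_sum`). The choice `h j t = exp (c j - l * t) + ∑ δ`, with `l ≥ 0`, is the
Chernoff bound for the total privacy loss (`adaptiveComp_real_le_exp_moment`); its constants come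
from the moment bound `exp_privacyLoss_moment_le`, which is `cosh a / cosh b ≤ exp ((a² - b²) / 2)`
for `0 ≤ b ≤ a`. Optimizing `l` gives the second exponent.
-/

/-! ### Test functions and two-sided closeness -/

lemma integral_mem_Icc {Y : Type*} [MeasurableSpace Y] (μ : Measure Y) [IsProbabilityMeasure μ]
    {f : Y → ℝ} (hf : Measurable f) (hf1 : ∀ y, f y ∈ Set.Icc 0 1) :
    ∫ y, f y ∂μ ∈ Set.Icc 0 1 := by
  refine ⟨integral_nonneg fun y => (hf1 y).1, ?_⟩
  simpa using integral_mono (μ := μ) (.of_mem_Icc 0 1 hf.aemeasurable (.of_forall hf1))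
    (integrable_const 1) fun y => (hf1 y).2

/-- The `(ε, δ)` inequality for events extends to test functions with values in `[0, C]`, by the
layer cake formula: integrate the inequality for the events `{s ≤ φ}` over `s ∈ [0, C]`. -/
lemma integral_le_exp_mul_integral_add {Y : Type*} [MeasurableSpace Y] {P Q : Measure Y}
    [IsProbabilityMeasure P] [IsProbabilityMeasure Q] {ε δ C : ℝ}
    (hPQ : ∀ S, MeasurableSet S → P.real S ≤ Real.exp ε * Q.real S + δ)
    {φ : Y → ℝ} (hφ : Measurable φ) (h0 : ∀ y, 0 ≤ φ y) (hC : ∀ y, φ y ≤ C) :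
    ∫ y, φ y ∂P ≤ Real.exp ε * ∫ y, φ y ∂Q + δ * C := by
  obtain ⟨y⟩ := nonempty_of_isProbabilityMeasure P
  have hC0 : 0 ≤ C := (h0 y).trans (hC y)
  have hint (μ : Measure Y) [IsProbabilityMeasure μ] : Integrable φ μ :=
    .of_bound hφ.aestronglyMeasurable C (.of_forall fun y => by
      rw [Real.norm_of_nonneg (h0 y)]; exact hC y)
  have hlayer (μ : Measure Y) [IsProbabilityMeasure μ] :
      ∫ y, φ y ∂μ = ∫ s in 0..C, μ.real {y | s ≤ φ y} := by
    rw [(hint μ).integral_eq_integral_Ioc_meas_le (.of_forall h0) (.of_forall hC),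
      intervalIntegral.integral_of_le hC0]
  have hii (μ : Measure Y) [IsProbabilityMeasure μ] :
      IntervalIntegrable (fun s => μ.real {y | s ≤ φ y}) volume 0 C := by
    refine Antitone.intervalIntegrable fun s t hst => ?_
    exact measureReal_mono fun y hy => hst.trans hy
  rw [hlayer P, hlayer Q, ← intervalIntegral.integral_const_mul]
  calc ∫ s in 0..C, P.real {y | s ≤ φ y}
      ≤ ∫ s in 0..C, (Real.exp ε * Q.real {y | s ≤ φ y} + δ) :=
        intervalIntegral.integral_mono_on hC0 (hii P)
          (((hii Q).const_mul _).add intervalIntegrable_const)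
          fun s _ => hPQ _ (measurableSet_le measurable_const hφ)
    _ = _ := by
        rw [intervalIntegral.integral_add ((hii Q).const_mul _) intervalIntegrable_const]
        simp [mul_comm]

/-- If the test function `m` is at least `exp (-ε) * (f - b)` below the threshold `f = κ`, and at
least its continuation with slope `exp ε` above, then `∫ f ∂P - ∫ m ∂Q` is bounded. Split `f` at
`κ`: the part above is transferred by the inequality `P ≤ exp ε * Q + δ`, the part between `b` and
`κ` by the reverse inequality, and each costs `δ` times the length of its range of values. -/
lemma integral_le_integral_add_of_threshold {Y : Type*} [MeasurableSpace Y] {P Q : Measure Y}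
    [IsProbabilityMeasure P] [IsProbabilityMeasure Q] {ε δ : ℝ} (hε : 0 ≤ ε) (hδ : 0 ≤ δ)
    (hPQ : ∀ S, MeasurableSet S → P.real S ≤ Real.exp ε * Q.real S + δ)
    (hQP : ∀ S, MeasurableSet S → Q.real S ≤ Real.exp ε * P.real S + δ)
    {f m : Y → ℝ} (hf : Measurable f) (hf1 : ∀ y, f y ∈ Set.Icc 0 1)
    (hm : Integrable m Q) (hm0 : ∀ y, 0 ≤ m y) {b κ : ℝ} (hb : 0 ≤ b) (hbκ : b ≤ κ)
    (hκ : κ ≤ 1) (hfb : ∀ y, f y - b ≤ Real.exp ε * m y)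
    (hfκ : ∀ y, κ ≤ f y → Real.exp ε * (f y - κ) + (κ - b) / Real.exp ε ≤ m y) :
    ∫ y, f y ∂P ≤ ∫ y, m y ∂Q + (κ - (κ - b) / Real.exp ε) + δ := by
  have hint (μ : Measure Y) [IsProbabilityMeasure μ] {φ : Y → ℝ} (hφ : Measurable φ)
      {C : ℝ} (h0 : ∀ y, 0 ≤ φ y) (h1 : ∀ y, φ y ≤ C) : Integrable φ μ :=
    .of_mem_Icc 0 C hφ.aemeasurable (.of_forall fun y => ⟨h0 y, h1 y⟩)
  set E := Real.exp ε
  have hE : 1 ≤ E := Real.one_le_exp hε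
  have hE0 : 0 < E := by linarith
  set φ : Y → ℝ := fun y => max (f y - κ) 0 with hφ
  set v : Y → ℝ := fun y => min (max (κ - f y) 0) (κ - b) with hv
  have hφm : Measurable φ := by fun_prop
  have hvm : Measurable v := by fun_prop
  have hφ0 (y : Y) : 0 ≤ φ y := le_max_right _ _
  have hφ1 (y : Y) : φ y ≤ 1 - κ := max_le (by linarith [(hf1 y).2]) (by linarith)
  have hv0 (y : Y) : 0 ≤ v y := le_min (le_max_right _ _) (by linarith)
  have hv1 (y : Y) : v y ≤ κ - b := min_le_right _ _
  have hφP := integral_le_exp_mul_integral_add hPQ hφm hφ0 hφ1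
  have hvQ := integral_le_exp_mul_integral_add hQP hvm hv0 hv1
  have hfle (y : Y) : f y ≤ φ y - v y + κ := by
    have h1 := le_max_left (f y - κ) 0
    rcases le_total (κ - f y) 0 with h | h
    · have : v y ≤ 0 := (min_le_left _ _).trans (max_le h le_rfl)
      simp only [hφ]; linarith
    · have : v y ≤ κ - f y := (min_le_left _ _).trans (max_le le_rfl h)
      linarith [hφ0 y]
  have hmle (y : Y) : E * φ y - v y / E + (κ - b) / E ≤ m y := by
    rcases le_total κ (f y) with h | h
    · have h1 : φ y = f y - κ := max_eq_left (by linarith)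
      have h2 : 0 ≤ v y / E := div_nonneg (hv0 y) hE0.le
      rw [h1]; linarith [hfκ y h]
    · have h1 : φ y = 0 := max_eq_right (by linarith)
      have h2 : v y = min (κ - f y) (κ - b) := by simp only [hv]; rw [max_eq_left (by linarith)]
      have h3 : (κ - b - v y) / E ≤ m y := by
        rw [div_le_iff₀ hE0, h2]
        rcases min_cases (κ - f y) (κ - b) with ⟨h, -⟩ | ⟨h, -⟩ <;> rw [h]
        · linarith [hfb y]
        · linarith [mul_nonneg (hm0 y) hE0.le]
      rw [h1]
      calc _ = (κ - b - v y) / E := by ring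
        _ ≤ _ := h3
  have hIP : ∫ y, f y ∂P ≤ ∫ y, φ y ∂P - ∫ y, v y ∂P + κ := by
    have hi := hint P hφm hφ0 hφ1
    have hi' := hint P hvm hv0 hv1
    calc ∫ y, f y ∂P ≤ ∫ y, (φ y - v y + κ) ∂P :=
          integral_mono (hint P hf (fun y => (hf1 y).1) fun y => (hf1 y).2)
            ((hi.sub hi').add (integrable_const _)) hfle
      _ = _ := by
          rw [integral_add (hi.sub' hi') (integrable_const _), integral_sub hi hi']
          simp
  have hIQ : E * ∫ y, φ y ∂Q - (∫ y, v y ∂Q) / E + (κ - b) / E ≤ ∫ y, m y ∂Q := by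
    have hi1 := (hint Q hφm hφ0 hφ1).const_mul E
    have hi2 := (hint Q hvm hv0 hv1).div_const E
    calc _ = ∫ y, (E * φ y - v y / E + (κ - b) / E) ∂Q := by
          rw [integral_add (hi1.sub' hi2) (integrable_const _), integral_sub hi1 hi2,
            integral_const_mul, integral_div]
          simp
      _ ≤ _ := integral_mono ((hi1.sub hi2).add (integrable_const _)) hm hmle
  have hvQ' : (∫ y, v y ∂Q) / E ≤ ∫ y, v y ∂P + δ * (κ - b) := by
    rw [div_le_iff₀ hE0]
    nlinarith [mul_nonneg (mul_nonneg hδ (sub_nonneg.2 hbκ)) (sub_nonneg.2 hE)]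
  -- The two errors `δ * (1 - κ)` and `δ * (κ - b)` add up to at most `δ`.
  have : δ * (1 - κ) + δ * (κ - b) ≤ δ := by nlinarith
  linarith

/-- One step of the composition. If `P` and `Q` are `(ε, δ)`-close in both directions, bounds for
`f` in terms of `g` at the levels `t - ε` and `t + ε` give a bound for `∫ f ∂P` in terms of
`∫ g ∂Q` at level `t`, whose additive term averages those of the two bounds with the weights of
randomized response, plus `δ`. Intuitively, outside an event of probability `δ` the pair `P`, `Q` is
obtained from randomized response by postprocessing. -/
lemma integral_le_exp_mul_integral_add_of_le {Y : Type*} [MeasurableSpace Y] {P Q : Measure Y}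
    [IsProbabilityMeasure P] [IsProbabilityMeasure Q] {ε δ : ℝ} (hε : 0 ≤ ε) (hδ : 0 ≤ δ)
    (hPQ : ∀ S, MeasurableSet S → P.real S ≤ Real.exp ε * Q.real S + δ)
    (hQP : ∀ S, MeasurableSet S → Q.real S ≤ Real.exp ε * P.real S + δ)
    {f g : Y → ℝ} (hf : Measurable f) (hf1 : ∀ y, f y ∈ Set.Icc 0 1)
    (hg : Measurable g) (hg1 : ∀ y, g y ∈ Set.Icc 0 1) {t a b : ℝ} (ha : 0 ≤ a) (hb : 0 ≤ b)
    (hfa : ∀ y, f y ≤ Real.exp (t - ε) * g y + a)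
    (hfb : ∀ y, f y ≤ Real.exp (t + ε) * g y + b) :
    ∫ y, f y ∂P ≤ Real.exp t * ∫ y, g y ∂Q +
      (Real.exp ε * a + b) / (1 + Real.exp ε) + δ := by
  set m : Y → ℝ := fun y => Real.exp t * g y
  have hmi : Integrable m Q :=
    (Integrable.of_mem_Icc 0 1 hg.aemeasurable (.of_forall hg1)).const_mul _
  have hm0 (y : Y) : 0 ≤ m y := mul_nonneg (Real.exp_nonneg _) (hg1 y).1
  have hfa' (y : Y) : Real.exp ε * (f y - a) ≤ m y := by
    have := mul_le_mul_of_nonneg_left (hfa y) (Real.exp_nonneg ε)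
    rw [mul_add, ← mul_assoc, ← Real.exp_add, add_sub_cancel] at this
    linarith
  have hfb' (y : Y) : f y - b ≤ Real.exp ε * m y := by
    have := hfb y
    rw [Real.exp_add] at this
    linarith
  have hP1 : ∫ y, f y ∂P ≤ 1 := (integral_mem_Icc P hf hf1).2
  rw [← integral_const_mul]
  have hQ0 : 0 ≤ ∫ y, m y ∂Q := integral_nonneg hm0
  have key {b κ : ℝ} (hb : 0 ≤ b) (hbκ : b ≤ κ) (hκ : κ ≤ 1) :=
    integral_le_integral_add_of_threshold hε hδ hPQ hQP hf hf1 hmi hm0 hb hbκ hκ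
  have hE : 1 ≤ Real.exp ε := Real.one_le_exp hε
  set E := Real.exp ε
  set c := (E * a + b) / (1 + E) with hc
  have hcE : c * (1 + E) = E * a + b := div_mul_cancel₀ _ (by positivity)
  change _ ≤ ∫ y, m y ∂Q + c + δ
  by_cases hc1 : 1 ≤ c
  · linarith
  push Not at hc1
  rcases le_total a b with hab | hba
  · -- Here `a ≤ c`, and the first bound implies the second one with `a` in place of `b`.
    have hac : a ≤ c := by nlinarith
    have h := key ha le_rfl (by linarith)
      (fun y => by nlinarith [hfa' y, hm0 y, mul_nonneg (hm0 y) (sub_nonneg.2 hE)])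
      (fun y _ => by simpa using hfa' y)
    rw [sub_self, zero_div, sub_zero] at h
    linarith
  have hbc : b ≤ c := by nlinarith
  rcases hE.eq_or_lt with hE1 | hE1
  · have h := key hb le_rfl (by linarith) hfb' (fun y _ => by
      have := hfb' y
      rw [← hE1] at this ⊢
      simpa using this)
    rw [sub_self, zero_div, sub_zero] at h
    linarith
  -- `κ` is the value of `f y` at which the two lower bounds for `m y` agree.
  set κ := (E ^ 2 * a - b) / (E ^ 2 - 1) with hκ
  have hE2 : 0 < E ^ 2 - 1 := by nlinarith
  have hκE : κ * (E ^ 2 - 1) = E ^ 2 * a - b := div_mul_cancel₀ _ hE2.ne'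
  have hκb : b ≤ κ := by rw [hκ, le_div_iff₀ hE2]; nlinarith
  have hval : κ - (κ - b) / E = c := by
    rw [hκ, hc]; field_simp; ring
  rcases le_total κ 1 with hκ1 | hκ1
  · have h := key hb hκb hκ1 hfb' (fun y _ => by
      have : (κ - b) / E = E * (κ - a) := by
        rw [div_eq_iff (by positivity)]; linarith
      linarith [hfa' y])
    linarith
  · have h := key hb (by linarith) le_rfl hfb' (fun y hy => by
      have h1 : f y = 1 := le_antisymm (hf1 y).2 hy
      have := hfb' y
      rw [h1] at this ⊢
      rw [sub_self, mul_zero, zero_add, div_le_iff₀ (by positivity)]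
      linarith)
    have : 1 - (1 - b) / E ≤ κ - (κ - b) / E := by
      have : (κ - b) / E - (1 - b) / E = (κ - 1) / E := by ring
      have := div_le_self (sub_nonneg.2 hκ1) hE
      linarith
    linarith

/-! ### The exponential moment of randomized response -/

lemma Real.sinh_le_mul_cosh {x : ℝ} (hx : 0 ≤ x) : Real.sinh x ≤ x * Real.cosh x := by
  have hmono : MonotoneOn (fun x : ℝ => x * Real.cosh x - Real.sinh x) (Set.Ici 0) := by
    refine monotoneOn_of_hasDerivWithinAt_nonneg (f' := fun x => x * Real.sinh x)
      (convex_Ici 0) (by fun_prop) (fun y _ => ?_) fun y hy => ?_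
    · refine HasDerivAt.hasDerivWithinAt ?_
      exact (((hasDerivAt_id' y).mul (Real.hasDerivAt_cosh y)).sub
        (Real.hasDerivAt_sinh y)).congr_deriv (by ring)
    · rw [interior_Ici] at hy
      exact mul_nonneg hy.le (Real.sinh_nonneg_iff.2 hy.le)
  simpa using hmono Set.self_mem_Ici hx hx

lemma Real.antitoneOn_cosh_mul_exp_neg_half_sq :
    AntitoneOn (fun x : ℝ => Real.cosh x * Real.exp (-(x ^ 2 / 2))) (Set.Ici 0) := by
  refine antitoneOn_of_hasDerivWithinAt_nonpos
    (f' := fun x => (Real.sinh x - x * Real.cosh x) * Real.exp (-(x ^ 2 / 2)))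
    (convex_Ici 0) (by fun_prop) (fun y _ => ?_) fun y hy => ?_
  · refine HasDerivAt.hasDerivWithinAt ?_
    exact ((Real.hasDerivAt_cosh y).mul
      ((((hasDerivAt_pow 2 y).div_const 2).fun_neg).exp)).congr_deriv (by push_cast; ring)
  · rw [interior_Ici] at hy
    exact mul_nonpos_of_nonpos_of_nonneg (sub_nonpos.2 (Real.sinh_le_mul_cosh hy.le))
      (Real.exp_nonneg _)

/-- Let `Z` be `ε` with probability `exp ε / (1 + exp ε)` and `-ε` otherwise: the privacy loss of
randomized response. Then `E[exp (l * Z)] ≤ exp (ε ^ 2 / 2 * l * (l + 1))`. -/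
lemma exp_privacyLoss_moment_le {ε l : ℝ} (hε : 0 ≤ ε) (hl : 0 ≤ l) :
    (Real.exp ε * Real.exp (l * ε) + Real.exp (-(l * ε))) / (1 + Real.exp ε) ≤
      Real.exp (1 / 2 * ε ^ 2 * (l * (l + 1))) := by
  have h := Real.antitoneOn_cosh_mul_exp_neg_half_sq (a := ε / 2) (b := (l + 1 / 2) * ε)
    (Set.mem_Ici.2 (by positivity)) (Set.mem_Ici.2 (by positivity)) (by nlinarith)
  simp only at h
  -- Multiplying numerator and denominator by `exp (-ε / 2)` turns the left side into a quotient
  -- of hyperbolic cosines.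
  have hnum : Real.exp ε * Real.exp (l * ε) + Real.exp (-(l * ε)) =
      2 * Real.exp (ε / 2) * Real.cosh ((l + 1 / 2) * ε) := by
    rw [Real.cosh_eq]
    calc _ = Real.exp (ε / 2 + (l + 1 / 2) * ε) + Real.exp (ε / 2 + -((l + 1 / 2) * ε)) := by
          rw [← Real.exp_add]; ring_nf
      _ = _ := by rw [Real.exp_add, Real.exp_add]; ring
  have hden : 1 + Real.exp ε = 2 * Real.exp (ε / 2) * Real.cosh (ε / 2) := by
    rw [Real.cosh_eq]
    calc _ = Real.exp (ε / 2 + -(ε / 2)) + Real.exp (ε / 2 + ε / 2) := by simp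
      _ = _ := by rw [Real.exp_add, Real.exp_add]; ring
  have hexp : Real.exp (1 / 2 * ε ^ 2 * (l * (l + 1))) =
      Real.exp (((l + 1 / 2) * ε) ^ 2 / 2) * Real.exp (-((ε / 2) ^ 2 / 2)) := by
    rw [← Real.exp_add]; ring_nf
  rw [div_le_iff₀ (by positivity), hnum, hden, hexp]
  have h2 : Real.cosh ((l + 1 / 2) * ε) ≤
      Real.exp (((l + 1 / 2) * ε) ^ 2 / 2) *
        (Real.cosh (ε / 2) * Real.exp (-((ε / 2) ^ 2 / 2))) := by
    calc _ = Real.exp (((l + 1 / 2) * ε) ^ 2 / 2) * (Real.cosh ((l + 1 / 2) * ε) *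
          Real.exp (-(((l + 1 / 2) * ε) ^ 2 / 2))) := by
          rw [mul_left_comm, ← Real.exp_add]; simp
      _ ≤ _ := by gcongr
  exact (mul_le_mul_of_nonneg_left h2 (by positivity)).trans_eq (by ring)

/-! ### Propagation of bounds along the composition -/

theorem adaptiveComp_succ {D : Type*} {k : ℕ} {Y : Fin (k + 1) → Type*}
    [∀ j, MeasurableSpace (Y j)] (M : (j : Fin k) → D → Kernel (Y j.castSucc) (Y j.succ))
    (y₀ : Y 0) (x : D) (j : Fin k) :
    adaptiveComp M y₀ x j.succ = (adaptiveComp M y₀ x j.castSucc).bind (M j x) :=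
  rfl

lemma integral_bind_kernel {α β : Type*} [MeasurableSpace α] [MeasurableSpace β]
    (μ : Measure α) [IsProbabilityMeasure μ] (κ : Kernel α β) [IsMarkovKernel κ] {f : β → ℝ}
    (hf : Integrable f (μ.bind κ)) : ∫ b, f b ∂μ.bind κ = ∫ a, ∫ b, f b ∂κ a ∂μ := by
  have h := Kernel.integral_comp (κ := Kernel.const Unit μ) (η := κ) (a := ()) (f := f)
  rw [Kernel.comp_apply, Kernel.const_apply] at h
  exact h hf

/-- If the additive terms `h j` satisfy the recursion of a single step, then a family of bounds for
`f` in terms of `g` at stage `j`, one for each level `t`, becomes a family of bounds for their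
expectations. In the induction, `f` and `g` are replaced by their conditional expectations given
the previous output; the single step is applied for each fixed previous output, so no measurable
choice is involved. -/
theorem integral_adaptiveComp_le {D : Type*} {k : ℕ} {Y : Fin (k + 1) → Type*}
    [∀ j, MeasurableSpace (Y j)] (M : (j : Fin k) → D → Kernel (Y j.castSucc) (Y j.succ))
    [∀ j x, IsMarkovKernel (M j x)] (y₀ : Y 0) {x x' : D} {ε δ : Fin k → ℝ}
    (hε : ∀ j, 0 ≤ ε j) (hδ : ∀ j, 0 ≤ δ j)
    (hM : ∀ j y S, MeasurableSet S →
      (M j x y).real S ≤ Real.exp (ε j) * (M j x' y).real S + δ j)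
    (hM' : ∀ j y S, MeasurableSet S →
      (M j x' y).real S ≤ Real.exp (ε j) * (M j x y).real S + δ j)
    {h : Fin (k + 1) → ℝ → ℝ} (h0 : ∀ j t, 0 ≤ h j t)
    (hh : ∀ (j : Fin k) t, (Real.exp (ε j) * h j.succ (t - ε j) + h j.succ (t + ε j)) /
      (1 + Real.exp (ε j)) + δ j ≤ h j.castSucc t)
    (j : Fin (k + 1)) {f g : Y j → ℝ} (hf : Measurable f) (hf1 : ∀ y, f y ∈ Set.Icc 0 1)
    (hg : Measurable g) (hg1 : ∀ y, g y ∈ Set.Icc 0 1)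
    (hfg : ∀ t y, f y ≤ Real.exp t * g y + h j t) (t : ℝ) :
    ∫ y, f y ∂adaptiveComp M y₀ x j ≤
      Real.exp t * ∫ y, g y ∂adaptiveComp M y₀ x' j + h 0 t := by
  induction j using Fin.induction with
  | zero =>
    change ∫ y, f y ∂Measure.dirac y₀ ≤ Real.exp t * ∫ y, g y ∂Measure.dirac y₀ + h 0 t
    rw [integral_dirac' _ _ hf.stronglyMeasurable, integral_dirac' _ _ hg.stronglyMeasurable]
    exact hfg t y₀
  | succ j ih =>
    rw [adaptiveComp_succ, adaptiveComp_succ,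
      integral_bind_kernel _ _ (.of_mem_Icc 0 1 hf.aemeasurable (.of_forall hf1)),
      integral_bind_kernel _ _ (.of_mem_Icc 0 1 hg.aemeasurable (.of_forall hg1))]
    refine ih hf.stronglyMeasurable.integral_kernel.measurable
      (fun y => integral_mem_Icc _ hf hf1)
      hg.stronglyMeasurable.integral_kernel.measurable
      (fun y => integral_mem_Icc _ hg hg1) fun s y => ?_
    have := integral_le_exp_mul_integral_add_of_le (hε j) (hδ j) (hM j y) (hM' j y) hf hf1 hg hg1
      (h0 _ _) (h0 _ _) (hfg (s - ε j)) (hfg (s + ε j))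
    linarith [hh j s]

/-- The event `S` in the last stage corresponds to the test functions `f = g = 1_S`, which satisfy
`f ≤ exp t * g + h t` as soon as `1 ≤ h t` for all negative `t`. -/
theorem adaptiveComp_real_le {D : Type*} {k : ℕ} {Y : Fin (k + 1) → Type*}
    [∀ j, MeasurableSpace (Y j)] (M : (j : Fin k) → D → Kernel (Y j.castSucc) (Y j.succ))
    [∀ j x, IsMarkovKernel (M j x)] (y₀ : Y 0) {x x' : D} {ε δ : Fin k → ℝ}
    (hε : ∀ j, 0 ≤ ε j) (hδ : ∀ j, 0 ≤ δ j)
    (hM : ∀ j y S, MeasurableSet S →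
      (M j x y).real S ≤ Real.exp (ε j) * (M j x' y).real S + δ j)
    (hM' : ∀ j y S, MeasurableSet S →
      (M j x' y).real S ≤ Real.exp (ε j) * (M j x y).real S + δ j)
    {h : Fin (k + 1) → ℝ → ℝ} (h0 : ∀ j t, 0 ≤ h j t)
    (hh : ∀ (j : Fin k) t, (Real.exp (ε j) * h j.succ (t - ε j) + h j.succ (t + ε j)) /
      (1 + Real.exp (ε j)) + δ j ≤ h j.castSucc t)
    (hlast : ∀ t < 0, 1 ≤ h (Fin.last k) t) {S : Set (Y (Fin.last k))} (hS : MeasurableSet S)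
    (t : ℝ) :
    (adaptiveComp M y₀ x (Fin.last k)).real S ≤
      Real.exp t * (adaptiveComp M y₀ x' (Fin.last k)).real S + h 0 t := by
  have hm : Measurable (S.indicator (1 : Y (Fin.last k) → ℝ)) := measurable_one.indicator hS
  have h1 (y : Y (Fin.last k)) : S.indicator (1 : Y (Fin.last k) → ℝ) y ∈ Set.Icc (0 : ℝ) 1 := by
    by_cases hy : y ∈ S <;> simp [hy]
  have := integral_adaptiveComp_le M y₀ hε hδ hM hM' h0 hh (Fin.last k) hm h1 hm h1
    (fun s y => ?_) t
  · rwa [integral_indicator_one hS, integral_indicator_one hS] at this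
  · rcases lt_or_ge s 0 with hs | hs
    · linarith [hlast s hs, (h1 y).2, mul_nonneg (Real.exp_nonneg s) (h1 y).1]
    · nlinarith [h0 (Fin.last k) s, (h1 y).1, Real.one_le_exp hs]

/-! ### Basic and advanced composition -/

/-- The sum of `w i` over the indices `i` of the steps that come after stage `j`. -/
def tailSum {k : ℕ} (w : Fin k → ℝ) (j : Fin (k + 1)) : ℝ :=
  ∑ i, if j ≤ i.castSucc then w i else 0

lemma tailSum_zero {k : ℕ} (w : Fin k → ℝ) : tailSum w 0 = ∑ i, w i := by
  simp [tailSum]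

lemma tailSum_last {k : ℕ} (w : Fin k → ℝ) : tailSum w (Fin.last k) = 0 := by
  refine Finset.sum_eq_zero fun i _ => if_neg ?_
  exact not_le.2 (Fin.castSucc_lt_last i)

lemma tailSum_castSucc {k : ℕ} (w : Fin k → ℝ) (j : Fin k) :
    tailSum w j.castSucc = tailSum w j.succ + w j := by
  have h : w j = ∑ i, if i = j then w i else 0 := by simp
  rw [h, tailSum, tailSum, ← Finset.sum_add_distrib]
  refine Finset.sum_congr rfl fun i _ => ?_
  simp only [Fin.le_def, Fin.ext_iff, Fin.val_castSucc, Fin.val_succ]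
  split_ifs <;> first | omega | simp

lemma tailSum_nonneg {k : ℕ} {w : Fin k → ℝ} (hw : ∀ i, 0 ≤ w i) (j : Fin (k + 1)) :
    0 ≤ tailSum w j :=
  Finset.sum_nonneg fun i _ => by split_ifs <;> simp [hw]

/-- Basic composition: the additive term is the indicator of `t` lying below the sum of the
remaining `ε j`, plus the sum of the remaining `δ j`. -/
theorem adaptiveComp_real_le_exp_sum {D : Type*} {k : ℕ} {Y : Fin (k + 1) → Type*}
    [∀ j, MeasurableSpace (Y j)] (M : (j : Fin k) → D → Kernel (Y j.castSucc) (Y j.succ))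
    [∀ j x, IsMarkovKernel (M j x)] (y₀ : Y 0) {x x' : D} {ε δ : Fin k → ℝ}
    (hε : ∀ j, 0 ≤ ε j) (hδ : ∀ j, 0 ≤ δ j)
    (hM : ∀ j y S, MeasurableSet S →
      (M j x y).real S ≤ Real.exp (ε j) * (M j x' y).real S + δ j)
    (hM' : ∀ j y S, MeasurableSet S →
      (M j x' y).real S ≤ Real.exp (ε j) * (M j x y).real S + δ j)
    {S : Set (Y (Fin.last k))} (hS : MeasurableSet S) :
    (adaptiveComp M y₀ x (Fin.last k)).real S ≤
      Real.exp (∑ j, ε j) * (adaptiveComp M y₀ x' (Fin.last k)).real S + ∑ j, δ j := by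
  have h := adaptiveComp_real_le M y₀ hε hδ hM hM'
    (h := fun j t => (if t < tailSum ε j then 1 else 0) + tailSum δ j)
    (fun j t => add_nonneg (by split_ifs <;> norm_num) (tailSum_nonneg hδ j))
    (fun j t => ?_) (fun t ht => ?_) hS (∑ j, ε j)
  · simpa [tailSum_zero] using h
  · have hE := Real.exp_pos (ε j)
    simp only [tailSum_castSucc]
    refine (add_le_add ?_ le_rfl).trans_eq (add_assoc _ _ _)
    rw [div_le_iff₀ (by positivity)]
    split_ifs <;> first | (exfalso; linarith [hε j]) | linarith
  · simp [tailSum_last, ht]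

/-- The bound from the moment of order `l` of the privacy loss: in the notation of
`exp_privacyLoss_moment_le`, the additive term is the Chernoff bound for the probability that the
sum of the remaining losses exceeds `t`, plus the sum of the remaining `δ j`. -/
theorem adaptiveComp_real_le_exp_moment {D : Type*} {k : ℕ} {Y : Fin (k + 1) → Type*}
    [∀ j, MeasurableSpace (Y j)] (M : (j : Fin k) → D → Kernel (Y j.castSucc) (Y j.succ))
    [∀ j x, IsMarkovKernel (M j x)] (y₀ : Y 0) {x x' : D} {ε δ : Fin k → ℝ}
    (hε : ∀ j, 0 ≤ ε j) (hδ : ∀ j, 0 ≤ δ j)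
    (hM : ∀ j y S, MeasurableSet S →
      (M j x y).real S ≤ Real.exp (ε j) * (M j x' y).real S + δ j)
    (hM' : ∀ j y S, MeasurableSet S →
      (M j x' y).real S ≤ Real.exp (ε j) * (M j x y).real S + δ j)
    {S : Set (Y (Fin.last k))} (hS : MeasurableSet S) {l : ℝ} (hl : 0 ≤ l) (t : ℝ) :
    (adaptiveComp M y₀ x (Fin.last k)).real S ≤
      Real.exp t * (adaptiveComp M y₀ x' (Fin.last k)).real S +
        (Real.exp (1 / 2 * (∑ j, ε j ^ 2) * (l * (l + 1)) - l * t) + ∑ j, δ j) := by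
  have h := adaptiveComp_real_le M y₀ hε hδ hM hM'
    (h := fun j t => Real.exp (1 / 2 * tailSum (fun i => ε i ^ 2) j * (l * (l + 1)) - l * t) +
      tailSum δ j)
    (fun j t => add_nonneg (Real.exp_nonneg _) (tailSum_nonneg hδ j))
    (fun j t => ?_) (fun t ht => ?_) hS t
  · simpa [tailSum_zero] using h
  · have hE : 1 + Real.exp (ε j) ≠ 0 := by positivity
    simp only [tailSum_castSucc]
    set r := 1 / 2 * tailSum (fun i => ε i ^ 2) j.succ * (l * (l + 1)) - l * t with hr
    have e1 : 1 / 2 * tailSum (fun i => ε i ^ 2) j.succ * (l * (l + 1)) - l * (t - ε j) =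
      r + l * ε j := by rw [hr]; ring
    have e2 : 1 / 2 * tailSum (fun i => ε i ^ 2) j.succ * (l * (l + 1)) - l * (t + ε j) =
      r + -(l * ε j) := by rw [hr]; ring
    have e3 : 1 / 2 * (tailSum (fun i => ε i ^ 2) j.succ + ε j ^ 2) * (l * (l + 1)) - l * t =
      r + 1 / 2 * ε j ^ 2 * (l * (l + 1)) := by rw [hr]; ring
    rw [e1, e2, e3, Real.exp_add, Real.exp_add, Real.exp_add]
    have := mul_le_mul_of_nonneg_left (exp_privacyLoss_moment_le (hε j) hl) (Real.exp_nonneg r)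
    calc _ = Real.exp r * ((Real.exp (ε j) * Real.exp (l * ε j) + Real.exp (-(l * ε j))) /
          (1 + Real.exp (ε j))) + tailSum δ j.succ + δ j := by field_simp; ring
      _ ≤ _ := by linarith
  · simp only [tailSum_last, add_zero, mul_zero, zero_mul, zero_sub]
    exact Real.one_le_exp (by nlinarith)

theorem mainTheorem1 {𝒳 : Type*} {n k : ℕ} (Nbr : (Fin n → 𝒳) → (Fin n → 𝒳) → Prop)
    (hNbr : ∀ x x', Nbr x x' → Nbr x' x)
    {Y : Fin (k + 1) → Type*} [∀ j, MeasurableSpace (Y j)]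
    (M : (j : Fin k) → (Fin n → 𝒳) → Kernel (Y j.castSucc) (Y j.succ))
    [∀ j x, IsMarkovKernel (M j x)]
    (ε δ : Fin k → ℝ) (hε : ∀ j, 0 ≤ ε j) (hδ : ∀ j, 0 ≤ δ j)
    (hM : ∀ (j : Fin k) (y : Y j.castSucc), IsApproxDP Nbr (ε j) (δ j) (fun x => M j x y))
    (y₀ : Y 0) (δtot : ℝ) (hδtot : ∑ j, δ j < δtot) :
    IsApproxDP Nbr
      (min (∑ j, ε j)
        (1 / 2 * ∑ j, ε j ^ 2 +
          Real.sqrt (2 * Real.log (1 / (δtot - ∑ j, δ j)) * ∑ j, ε j ^ 2)))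
      δtot
      (fun x => adaptiveComp M y₀ x (Fin.last k)) := by
  intro x x' hx S hS
  have hM1 (j : Fin k) (y : Y j.castSucc) (S : Set (Y j.succ)) (hS : MeasurableSet S) :=
    hM j y x x' hx S hS
  have hM2 (j : Fin k) (y : Y j.castSucc) (S : Set (Y j.succ)) (hS : MeasurableSet S) :=
    hM j y x' x (hNbr x x' hx) S hS
  have hbasic := adaptiveComp_real_le_exp_sum M y₀ hε hδ hM1 hM2 hS
  have hQ : 0 ≤ (adaptiveComp M y₀ x' (Fin.last k)).real S := measureReal_nonneg
  rcases min_choice (∑ j, ε j) (1 / 2 * ∑ j, ε j ^ 2 +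
    Real.sqrt (2 * Real.log (1 / (δtot - ∑ j, δ j)) * ∑ j, ε j ^ 2)) with h | h <;> rw [h]
  · linarith
  clear h
  set s := ∑ j, ε j ^ 2 with hs
  set d := δtot - ∑ j, δ j
  have hd0 : 0 < d := sub_pos.2 hδtot
  have hs0 : 0 ≤ s := Finset.sum_nonneg fun j _ => sq_nonneg _
  rcases hs0.eq_or_lt with hs0 | hs0
  · have hε0 (j : Fin k) : ε j = 0 := by
      have := (Finset.sum_eq_zero_iff_of_nonneg fun j _ => sq_nonneg (ε j)).1 hs0.symm j
        (Finset.mem_univ j)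
      exact pow_eq_zero_iff two_ne_zero |>.1 this
    simp only [hε0, Finset.sum_const_zero] at hbasic
    simp only [← hs0, mul_zero, Real.sqrt_zero, add_zero]
    linarith
  rcases le_total 1 d with hd1 | hd1
  · have hP : (adaptiveComp M y₀ x (Fin.last k)).real S ≤ 1 := measureReal_le_one
    have := mul_nonneg (Real.exp_nonneg (1 / 2 * s + Real.sqrt (2 * Real.log (1 / d) * s))) hQ
    have := Finset.sum_nonneg fun j (_ : j ∈ Finset.univ) => hδ j
    linarith
  set r := Real.sqrt (2 * Real.log (1 / d) * s)
  have hlog : 0 ≤ Real.log (1 / d) := Real.log_nonneg (by rwa [one_le_div hd0])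
  have hr2 : r ^ 2 = 2 * Real.log (1 / d) * s := Real.sq_sqrt (by positivity)
  -- `l = r / s` minimizes the exponent `s * l ^ 2 / 2 - l * r`, with minimum `log d`.
  have h := adaptiveComp_real_le_exp_moment M y₀ hε hδ hM1 hM2 hS
    (l := r / s) (div_nonneg (Real.sqrt_nonneg _) hs0.le) (1 / 2 * s + r)
  have hexp : 1 / 2 * s * (r / s * (r / s + 1)) - r / s * (1 / 2 * s + r) = Real.log d := by
    have : 1 / 2 * s * (r / s * (r / s + 1)) - r / s * (1 / 2 * s + r) = -(r ^ 2 / (2 * s)) := by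
      field_simp; ring
    rw [this, hr2, one_div, Real.log_inv]
    field_simp
  rw [← hs, hexp, Real.exp_log hd0] at h
  linarith
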